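/- Let $S$ be a finite set of modes, $A_s\in\mathbb{R}^{n\times n}$ ($s\in S$), and consider the switched linear system $x(k+1)=A_{s_k}x(k)$. The mode switches are governed by a finite Markov decision process $\mathcal M=(S,\hat s,\Sigma,T)$ with initial mode $\hat s$ and a randomized policy $\pi$ (choosing, at each state, among the actions defined there). That is, $(s_k)_{k\ge 0}$ is a Markov chain with $s_0=\hat s$ and transition matrix $P_{ss'}=\sum_{\sigma}T(s,\sigma,s')\pi(s,\sigma)$. Let $0<\alpha<1$ and $\mu>1$, and suppose there is a Lyapunov function candidate $\{V_s\}_{s\in S}$ (each $V_s:\mathbb{R}^n\to\mathbb{R}$ is continuous, $V_s(0)=0$, and $V_s(x)>0$ for $x\ne 0$) such that for all $s,s'\in S$ and all $x\in\mathbb{R}^n$ $$V_s(A_s x)-V_s(x)\le-\alpha V_s(x),\qquad V_s(x)\le\mu V_{s'}(x).$$ Suppose that the chain $P$ has a unique stationary distribution $p^\infty$, and let $P_{jump}=1-\sum_s p^\infty_sP_{ss}$ be the stationary probability of a mode jump. If $$P_{jump}<\frac{\ln\left(\frac{1}{1-\alpha}\right)}{\ln\mu},$$ then the system is stable with probability one: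 for every initial condition $x(0)=x_0\in\mathbb{R}^n$, $\lim_{k\to\infty}\|x(k)\|_\infty=0$ with probability one. -/

import Mathlib

open MeasureTheory Filter Topology

/-- A Markov decision process with finite state (mode) set `S`, initial state `init` and finite
action set `Act`. `T s σ s'` is the probability of moving from `s` to `s'` under `σ`;
if `σ` is not defined on `s` then the row `T s σ` is zero. -/
structure MDP (S Act : Type*) [Fintype S] where
  init : S
  T : S → Act → S → ℝ
  T_nonneg : ∀ s σ s', 0 ≤ T s σ s'
  T_row : ∀ s σ, (∑ s', T s σ s' = 1) ∨ (∀ s', T s σ s' = 0)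

/-- A randomized policy of `M`: at each state, a probability distribution on the actions that are
defined there. -/
structure MDP.Policy {S Act : Type*} [Fintype S] [Fintype Act] (M : MDP S Act) where
  prob : S → Act → ℝ
  prob_nonneg : ∀ s σ, 0 ≤ prob s σ
  prob_sum : ∀ s, ∑ σ, prob s σ = 1
  prob_undefined : ∀ s σ, (∀ s', M.T s σ s' = 0) → prob s σ = 0

/-- A discrete time Markov chain `(S, init, P)` with finite state set `S`. -/
structure DTMC (S : Type*) [Fintype S] where
  init : S
  P : S → S → ℝ
  P_nonneg : ∀ s s', 0 ≤ P s s'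
  P_row : ∀ s, ∑ s', P s s' = 1

/-- The Markov chain induced by a policy, `P s s' = ∑ σ, T s σ s' * π s σ`. -/
def MDP.induced {S Act : Type*} [Fintype S] [Fintype Act] (M : MDP S Act) (π : M.Policy) :
    DTMC S where
  init := M.init
  P s s' := ∑ σ, M.T s σ s' * π.prob s σ
  P_nonneg s s' := Finset.sum_nonneg fun σ _ => mul_nonneg (M.T_nonneg s σ s') (π.prob_nonneg s σ)
  P_row s := by
    rw [Finset.sum_comm, ← π.prob_sum s]
    refine Finset.sum_congr rfl fun σ _ => ?_
    rw [← Finset.sum_mul]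
    rcases M.T_row s σ with h | h
    · rw [h, one_mul]
    · rw [π.prob_undefined s σ h, mul_zero]

namespace DTMC

variable {S : Type*} [Fintype S]

/-- `p` is a stationary distribution of `C`. -/
structure IsStationary (C : DTMC S) (p : S → ℝ) : Prop where
  nonneg : ∀ s, 0 ≤ p s
  sum_eq_one : ∑ s, p s = 1
  balance : ∀ s, p s = ∑ s', p s' * C.P s' s

/-- The probability of a mode jump, `1 - ∑ s, p s * P s s`, for a stationary distribution `p`. -/
def jumpProb (C : DTMC S) (p : S → ℝ) : ℝ := 1 - ∑ s, p s * C.P s s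

/-- The random sequence `s` on the probability space `(Ω, ℙ)` is a Markov chain governed by `C`:
it starts at `C.init`, and
`ℙ (s 0 = a 0, …, s k = a k) = P (a 0) (a 1) * ⋯ * P (a (k-1)) (a k)` when `a 0 = C.init`. -/
structure IsRealization (C : DTMC S) {Ω : Type*} [MeasurableSpace Ω] (ℙ : Measure Ω)
    (s : ℕ → Ω → S) : Prop where
  measurableSet_eq : ∀ k a, MeasurableSet {ω | s k ω = a}
  init_eq : ∀ᵐ ω ∂ℙ, s 0 ω = C.init
  fdd : ∀ (k : ℕ) (a : ℕ → S), a 0 = C.init →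
    ℙ {ω | ∀ i ≤ k, s i ω = a i} = ENNReal.ofReal (∏ i ∈ Finset.range k, C.P (a i) (a (i + 1)))

end DTMC

/-- The trajectory of the switched linear system `x (k+1) = A (s k) x k`, `x 0 = x₀`, along the
mode sequence `s`. -/
def switchedState {S : Type*} {n : ℕ} (A : S → Matrix (Fin n) (Fin n) ℝ) (x₀ : Fin n → ℝ)
    (s : ℕ → S) : ℕ → (Fin n → ℝ)
  | 0 => x₀
  | k + 1 => (A (s k)).mulVec (switchedState A x₀ s k)

/-- Stability with probability one of the switched linear system with random mode sequence `s`: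
for every initial condition `x₀`, almost surely `‖x k‖_∞ → 0`.
(The norm of `Fin n → ℝ` is the maximum norm.) -/
def StableWithProbabilityOne {S : Type*} {n : ℕ} (A : S → Matrix (Fin n) (Fin n) ℝ)
    {Ω : Type*} [MeasurableSpace Ω] (ℙ : Measure Ω) (s : ℕ → Ω → S) : Prop :=
  ∀ x₀ : Fin n → ℝ, ∀ᵐ ω ∂ℙ,
    Tendsto (fun k => ‖switchedState A x₀ (fun i => s i ω) k‖) atTop (𝓝 0)

/-- A Lyapunov function candidate `{V s}`: each `V s` is continuous and positive definite. -/
structure IsLyapunovCandidate {S : Type*} {n : ℕ} (V : S → (Fin n → ℝ) → ℝ) : Prop where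
  continuous : ∀ s, Continuous (V s)
  zero : ∀ s, V s 0 = 0
  pos : ∀ s x, x ≠ 0 → 0 < V s x

/-!
Along a trajectory, `V (s k) (x k)` is multiplied in each step by at most `exp ℓ`, where
`ℓ (s k) (s (k+1))` is `log (1 - α)`, increased by `log μ` if the mode jumps. The bound on the jump
probability says that `ℓ` has negative mean under the stationary distribution, and the proof shows
that the sums of such an `ℓ` along the chain almost surely tend to `-∞`
(`DTMC.IsRealization.ae_tendsto_sum_atBot`).

No ergodic theorem is needed for this. Uniqueness of the stationary distribution `p` means that the
left fixed vectors of `P` are the multiples of `p` (`DTMC.eq_smul_of_leftFixed`), so by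
duality the Poisson equation `h - P h = f - ∑ p f` is solvable (`DTMC.exists_poisson`). Replacing
`ℓ s s'` by `ℓ s s' + h s' - h s` changes the sums by a bounded amount only, and makes the mean of
the next increment the same negative number at every state. For small `θ > 0` the mean of
`exp (θ * increment)` is then at most some `ρ < 1` at every state, so the expected
exponential of the sum of `k` increments is at most `ρ ^ k`, which is summable; hence
the exponentials tend to `0` almost surely.

The functions `V s` need not be proper, so `V (s k) (x k) → 0` does not bound `x k` by itself.
By linearity the initial state may be scaled down until `V (s k) (x k)` stays
below the minimum of all `V s` on an annulus `1 ≤ ‖x‖ ≤ L` that is too thick to be jumped over in a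
single step; the trajectory then stays in the unit ball, where small values of `V s` do
force small norms (`tendsto_norm_switchedState`).
-/

/-! ### The Poisson equation of a finite Markov chain -/

namespace DTMC

variable {S : Type*} [Fintype S]

lemma IsStationary.eq_smul_of_nonneg {C : DTMC S} {p : S → ℝ}
    (hunique : ∀ q, C.IsStationary q → q = p) {v : S → ℝ} (h0 : ∀ s, 0 ≤ v s)
    (hv : ∀ s, v s = ∑ s', v s' * C.P s' s) : ∃ c : ℝ, ∀ s, v s = c * p s := by
  rcases (Finset.sum_nonneg fun s (_ : s ∈ Finset.univ) => h0 s).eq_or_lt with h | h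
  · refine ⟨0, fun s => ?_⟩
    rw [zero_mul]
    exact (Finset.sum_eq_zero_iff_of_nonneg fun s _ => h0 s).1 h.symm s (Finset.mem_univ s)
  · refine ⟨∑ s, v s, fun s => ?_⟩
    have hq : C.IsStationary fun s => v s / ∑ t, v t :=
      { nonneg := fun s => div_nonneg (h0 s) h.le
        sum_eq_one := by rw [← Finset.sum_div, div_self h.ne']
        balance := fun s => by
          simp only [div_mul_eq_mul_div]
          rw [← Finset.sum_div, ← hv s] }
    rw [← hunique _ hq]
    field_simp

/-- The positive part of a left fixed vector of `P` is a left fixed vector: it is dominated by its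
image under `P`, and both have the same sum. -/
lemma posPart_leftFixed (C : DTMC S) {v : S → ℝ}
    (hv : ∀ s, v s = ∑ s', v s' * C.P s' s) (s : S) :
    max (v s) 0 = ∑ s', max (v s') 0 * C.P s' s := by
  have hle : ∀ s ∈ Finset.univ, max (v s) 0 ≤ ∑ s', max (v s') 0 * C.P s' s := by
    intro s _
    refine max_le ?_ (Finset.sum_nonneg fun s' _ =>
      mul_nonneg (le_max_right _ _) (C.P_nonneg _ _))
    rw [hv s]
    exact Finset.sum_le_sum fun s' _ =>
      mul_le_mul_of_nonneg_right (le_max_left _ _) (C.P_nonneg _ _)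
  refine (Finset.sum_eq_sum_iff_of_le hle).1 ?_ s (Finset.mem_univ s)
  rw [Finset.sum_comm]
  simp only [← Finset.mul_sum, C.P_row, mul_one]

lemma eq_smul_of_leftFixed {C : DTMC S} {p : S → ℝ}
    (hunique : ∀ q, C.IsStationary q → q = p) {v : S → ℝ}
    (hv : ∀ s, v s = ∑ s', v s' * C.P s' s) : ∃ c : ℝ, ∀ s, v s = c * p s := by
  have hv' : ∀ s, -v s = ∑ s', -v s' * C.P s' s := fun s => by
    simp only [neg_mul, Finset.sum_neg_distrib, ← hv s]
  obtain ⟨c, hc⟩ := IsStationary.eq_smul_of_nonneg hunique (fun s => le_max_right (v s) 0)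
    (C.posPart_leftFixed hv)
  obtain ⟨d, hd⟩ := IsStationary.eq_smul_of_nonneg hunique (fun s => le_max_right (-v s) 0)
    (C.posPart_leftFixed hv')
  refine ⟨c - d, fun s => ?_⟩
  rw [sub_mul, ← hc s, ← hd s]
  rcases le_total (v s) 0 with h | h
  · rw [max_eq_right h, max_eq_left (neg_nonneg.2 h)]; ring
  · rw [max_eq_left h, max_eq_right (neg_nonpos.2 h)]; ring

/-- Solvability of the Poisson equation: a linear functional that vanishes on the range of `1 - P`
is a left fixed vector of `P`, hence a multiple of `p`. -/
lemma exists_poisson {C : DTMC S} {p : S → ℝ}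
    (hunique : ∀ q, C.IsStationary q → q = p) {f : S → ℝ} (hf : ∑ s, p s * f s = 0) :
    ∃ h : S → ℝ, ∀ s, h s - ∑ s', C.P s s' * h s' = f s := by
  classical
  let D : (S → ℝ) →ₗ[ℝ] (S → ℝ) := LinearMap.id - Matrix.mulVecLin (Matrix.of C.P)
  have hD : ∀ h s, D h s = h s - ∑ s', C.P s s' * h s' := fun h s => rfl
  suffices hmem : f ∈ LinearMap.range D by
    obtain ⟨h, hh⟩ := hmem
    exact ⟨h, fun s => by rw [← hD, hh]⟩
  by_contra hnot
  obtain ⟨φ, hφf, hφ⟩ := Submodule.exists_le_ker_of_notMem hnot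
  have hφsum : ∀ g : S → ℝ, φ g = ∑ s, g s * φ (Pi.single s 1) := fun g => by
    conv_lhs => rw [pi_eq_sum_univ' g]
    simp [map_sum]
  have hfix : ∀ s, φ (Pi.single s 1) = ∑ s', φ (Pi.single s' 1) * C.P s' s := fun s => by
    have h0 : φ (D (Pi.single s 1)) = 0 := hφ ⟨_, rfl⟩
    have h1 : D (Pi.single s 1) = Pi.single s 1 - fun t => C.P t s := by
      ext t
      simp [hD, Pi.single_apply]
    rw [h1, map_sub, sub_eq_zero, hφsum fun t => C.P t s] at h0
    rw [h0]
    exact Finset.sum_congr rfl fun t _ => mul_comm _ _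
  obtain ⟨c, hc⟩ := eq_smul_of_leftFixed hunique hfix
  apply hφf
  rw [hφsum]
  calc ∑ s, f s * φ (Pi.single s 1) = c * ∑ s, p s * f s := by
        rw [Finset.mul_sum]
        exact Finset.sum_congr rfl fun s _ => by rw [hc s]; ring
    _ = 0 := by rw [hf, mul_zero]

/-! ### Exponential moments along the chain -/

/-- If the increments `y` have the same negative mean `-ε` at every state, then a small multiple of
them has exponential moments below `1`, since `exp x ≤ 1 + x + x ^ 2` for small `x`. -/
lemma exists_exp_moment_lt_one (C : DTMC S) (y : S → S → ℝ) {ε : ℝ} (hε : 0 < ε)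
    (hy : ∀ s, ∑ s', C.P s s' * y s s' = -ε) :
    ∃ θ ρ : ℝ, 0 < θ ∧ 0 ≤ ρ ∧ ρ < 1 ∧
      ∀ s, ∑ s', C.P s s' * Real.exp (θ * y s s') ≤ ρ := by
  obtain ⟨B, hB1, hBε, hB⟩ : ∃ B : ℝ, 1 ≤ B ∧ ε ≤ B ∧ ∀ s s', |y s s'| ≤ B := by
    have hnn : 0 ≤ ∑ s, ∑ s', |y s s'| :=
      Finset.sum_nonneg fun s _ => Finset.sum_nonneg fun s' _ => abs_nonneg _
    refine ⟨∑ s, ∑ s', |y s s'| + 1 + ε, by linarith, by linarith, fun s s' => ?_⟩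
    have h1 : |y s s'| ≤ ∑ s', |y s s'| :=
      Finset.single_le_sum (f := fun s' => |y s s'|) (fun _ _ => abs_nonneg _)
        (Finset.mem_univ s')
    have h2 : ∑ s', |y s s'| ≤ ∑ s, ∑ s', |y s s'| :=
      Finset.single_le_sum (f := fun s => ∑ s', |y s s'|)
        (fun _ _ => Finset.sum_nonneg fun _ _ => abs_nonneg _) (Finset.mem_univ s)
    linarith
  have hBpos : 0 < B := by linarith
  -- this `θ` minimizes the bound `1 - θ * ε + (θ * B) ^ 2`
  obtain ⟨θ, hθ⟩ : ∃ θ, θ = ε / (2 * B ^ 2) := ⟨_, rfl⟩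
  have hθpos : 0 < θ := by rw [hθ]; positivity
  have hεB : ε / B ≤ 1 := (div_le_one hBpos).2 hBε
  have hεB0 : 0 < ε / B := by positivity
  have hθB : θ * B = ε / B / 2 := by rw [hθ]; field_simp
  have hθε : θ * ε = (ε / B) ^ 2 / 2 := by rw [hθ]; field_simp
  refine ⟨θ, 1 - θ * ε + (θ * B) ^ 2, hθpos, ?_, ?_, fun s => ?_⟩
  · rw [hθB, hθε]; nlinarith
  · rw [hθB, hθε]; nlinarith
  · have hstep : ∀ s', Real.exp (θ * y s s') ≤ 1 + θ * y s s' + (θ * B) ^ 2 := fun s' => by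
      have habs : |θ * y s s'| ≤ θ * B := by
        rw [abs_mul, abs_of_pos hθpos]
        exact mul_le_mul_of_nonneg_left (hB s s') hθpos.le
      have h1 := (abs_le.1 (Real.abs_exp_sub_one_sub_id_le (x := θ * y s s')
        (by linarith))).2
      have h2 : (θ * y s s') ^ 2 ≤ (θ * B) ^ 2 := sq_le_sq' (by linarith [(abs_le.1 habs).1])
        (le_of_abs_le habs)
      linarith
    calc ∑ s', C.P s s' * Real.exp (θ * y s s')
        ≤ ∑ s', C.P s s' * (1 + θ * y s s' + (θ * B) ^ 2) :=
          Finset.sum_le_sum fun s' _ => mul_le_mul_of_nonneg_left (hstep s') (C.P_nonneg _ _)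
      _ = (∑ s', C.P s s') * (1 + (θ * B) ^ 2) + θ * ∑ s', C.P s s' * y s s' := by
          rw [Finset.sum_mul, Finset.mul_sum, ← Finset.sum_add_distrib]
          exact Finset.sum_congr rfl fun s' _ => by ring
      _ = 1 - θ * ε + (θ * B) ^ 2 := by rw [C.P_row, hy]; ring

/-- The total weight of all paths of length `k` from a given state, for a transition weight with row
sums at most `ρ`. -/
lemma sum_path_weight_le [DecidableEq S] (w : S → S → ℝ) (hw : ∀ s s', 0 ≤ w s s') {ρ : ℝ}
    (hρ : ∀ s, ∑ s', w s s' ≤ ρ) (k : ℕ) (s₀ : S) :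
    ∑ a : Fin (k + 1) → S, (if a 0 = s₀ then ∏ i : Fin k, w (a i.castSucc) (a i.succ) else 0)
      ≤ ρ ^ k := by
  induction k with
  | zero =>
    rw [← (Equiv.funUnique (Fin 1) S).symm.sum_comp]
    simp
  | succ k ih =>
    have hρ0 : 0 ≤ ρ := (Finset.sum_nonneg fun s' _ => hw s₀ s').trans (hρ s₀)
    rw [← (Fin.snocEquiv fun _ : Fin (k + 2) => S).sum_comp, Fintype.sum_prod_type_right]
    calc _ = ∑ a : Fin (k + 1) → S,
          (if a 0 = s₀ then ∏ i : Fin k, w (a i.castSucc) (a i.succ) else 0)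
            * ∑ s', w (a (Fin.last k)) s' := by
          refine Finset.sum_congr rfl fun a _ => ?_
          rw [Finset.mul_sum]
          refine Finset.sum_congr rfl fun s' _ => ?_
          have h0 : (Fin.snoc a s' : Fin (k + 2) → S) 0 = a 0 :=
            Fin.snoc_castSucc (α := fun _ => S) s' a 0
          simp only [Fin.snocEquiv, Equiv.coe_fn_mk, h0, ite_mul, zero_mul,
            Fin.prod_univ_castSucc, Fin.succ_castSucc, Fin.snoc_castSucc, Fin.succ_last,
            Fin.snoc_last]
      _ ≤ ∑ a : Fin (k + 1) → S,
          (if a 0 = s₀ then ∏ i : Fin k, w (a i.castSucc) (a i.succ) else 0) * ρ := by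
          refine Finset.sum_le_sum fun a _ => mul_le_mul_of_nonneg_left (hρ _) ?_
          split_ifs
          · exact Finset.prod_nonneg fun _ _ => hw _ _
          · exact le_rfl
      _ ≤ ρ ^ (k + 1) := by
          rw [← Finset.sum_mul, pow_succ]
          exact mul_le_mul_of_nonneg_right ih hρ0

variable {Ω : Type*} [MeasurableSpace Ω] {ℙ : Measure Ω}

lemma IsRealization.measurableSet_path {C : DTMC S} {s : ℕ → Ω → S} (hs : C.IsRealization ℙ s)
    (k : ℕ) (a : Fin (k + 1) → S) : MeasurableSet {ω | ∀ i : Fin (k + 1), s i ω = a i} := by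
  rw [Set.ofPred_forall]
  exact MeasurableSet.iInter fun i => hs.measurableSet_eq i (a i)

lemma IsRealization.measure_path [DecidableEq S] {C : DTMC S} {s : ℕ → Ω → S}
    (hs : C.IsRealization ℙ s) (k : ℕ) (a : Fin (k + 1) → S) :
    ℙ {ω | ∀ i : Fin (k + 1), s i ω = a i} =
      if a 0 = C.init then ENNReal.ofReal (∏ i : Fin k, C.P (a i.castSucc) (a i.succ)) else 0 := by
  split_ifs with h0
  · have hval : ∀ i : Fin (k + 1), a (Fin.ofNat (k + 1) i) = a i := fun i => by
      congr 1
      ext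
      simp
    have := hs.fdd k (fun i => a (Fin.ofNat (k + 1) i)) h0
    rw [Finset.prod_range] at this
    have hset : {ω | ∀ i : Fin (k + 1), s i ω = a i} =
        {ω | ∀ i ≤ k, s i ω = a (Fin.ofNat (k + 1) i)} := by
      ext ω
      refine ⟨fun h i hi => ?_, fun h i => ?_⟩
      · have := h ⟨i, Nat.lt_succ_of_le hi⟩
        rw [← hval ⟨i, Nat.lt_succ_of_le hi⟩] at this
        exact this
      · rw [← hval i]
        exact h i (Nat.le_of_lt_succ i.2)
    rw [hset, this]
    refine congrArg _ (Finset.prod_congr rfl fun i _ => ?_)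
    rw [← hval i.castSucc, ← hval i.succ]
    rfl
  · refine measure_mono_null (fun ω hω => ?_) (ae_iff.1 hs.init_eq)
    exact fun hinit => h0 ((hω 0).symm.trans hinit)

/-- The expectation of a product of transition factors decays geometrically if at every state the
mean of the next factor is at most `ρ`. -/
lemma IsRealization.lintegral_prod_le {C : DTMC S} {s : ℕ → Ω → S} (hs : C.IsRealization ℙ s)
    (g : S → S → ℝ) (hg : ∀ t t', 0 ≤ g t t') {ρ : ℝ}
    (hρ : ∀ t, ∑ t', C.P t t' * g t t' ≤ ρ) (k : ℕ) :
    ∫⁻ ω, ENNReal.ofReal (∏ i ∈ Finset.range k, g (s i ω) (s (i + 1) ω)) ∂ℙ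
      ≤ ENNReal.ofReal (ρ ^ k) := by
  classical
  have hpath : ∀ ω, ENNReal.ofReal (∏ i ∈ Finset.range k, g (s i ω) (s (i + 1) ω)) =
      ∑ a : Fin (k + 1) → S, {ω | ∀ i : Fin (k + 1), s i ω = a i}.indicator
        (fun _ => ENNReal.ofReal (∏ i : Fin k, g (a i.castSucc) (a i.succ))) ω := fun ω => by
    rw [Finset.sum_eq_single (fun i : Fin (k + 1) => s i ω), Set.indicator_of_mem,
      Finset.prod_range]
    · rfl
    · exact fun i => rfl
    · intro a _ ha
      refine Set.indicator_of_notMem (fun h => ha ?_) _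
      exact (funext h).symm
    · simp
  simp only [hpath]
  rw [lintegral_finsetSum _ fun a _ => measurable_const.indicator (hs.measurableSet_path k a)]
  have hterm : ∀ a : Fin (k + 1) → S,
      ∫⁻ ω, {ω | ∀ i : Fin (k + 1), s i ω = a i}.indicator
        (fun _ => ENNReal.ofReal (∏ i : Fin k, g (a i.castSucc) (a i.succ))) ω ∂ℙ =
      ENNReal.ofReal (if a 0 = C.init then
        ∏ i : Fin k, C.P (a i.castSucc) (a i.succ) * g (a i.castSucc) (a i.succ) else 0) :=
    fun a => by
      rw [lintegral_indicator_const (hs.measurableSet_path k a), hs.measure_path]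
      split_ifs
      · rw [← ENNReal.ofReal_mul (Finset.prod_nonneg fun _ _ => hg _ _), mul_comm,
          Finset.prod_mul_distrib]
      · simp
  simp only [hterm]
  have hw : ∀ t t', 0 ≤ C.P t t' * g t t' := fun t t' => mul_nonneg (C.P_nonneg _ _) (hg _ _)
  rw [← ENNReal.ofReal_sum_of_nonneg]
  · exact ENNReal.ofReal_le_ofReal (sum_path_weight_le _ hw hρ k C.init)
  · intro a _
    split_ifs
    · exact Finset.prod_nonneg fun _ _ => hw _ _
    · exact le_rfl

/-- If the mean of `ℓ` per transition is negative under the unique stationary distribution, then the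
sums of `ℓ` along the chain almost surely tend to `-∞`. -/
theorem IsRealization.ae_tendsto_sum_atBot {C : DTMC S} {s : ℕ → Ω → S}
    (hs : C.IsRealization ℙ s) {p : S → ℝ} (hp : C.IsStationary p)
    (hunique : ∀ q, C.IsStationary q → q = p) (ℓ : S → S → ℝ)
    (hneg : ∑ t, p t * ∑ t', C.P t t' * ℓ t t' < 0) :
    ∀ᵐ ω ∂ℙ, Tendsto (fun k => ∑ i ∈ Finset.range k, ℓ (s i ω) (s (i + 1) ω)) atTop atBot := by
  obtain ⟨ε, hε⟩ : ∃ ε, ε = -∑ t, p t * ∑ t', C.P t t' * ℓ t t' := ⟨_, rfl⟩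
  obtain ⟨h, hh⟩ := exists_poisson hunique (f := fun t => (∑ t', C.P t t' * ℓ t t') + ε) (by
    simp only [mul_add, Finset.sum_add_distrib, ← Finset.sum_mul, hp.sum_eq_one]
    rw [hε]
    ring)
  have hmean : ∀ t, ∑ t', C.P t t' * (ℓ t t' + h t' - h t) = -ε := fun t => by
    simp only [mul_add, mul_sub, Finset.sum_add_distrib, Finset.sum_sub_distrib,
      ← Finset.sum_mul, C.P_row]
    linarith [hh t]
  obtain ⟨θ, ρ, hθ, hρ0, hρ1, hρ⟩ :=
    C.exists_exp_moment_lt_one (fun t t' => ℓ t t' + h t' - h t) (by linarith) hmean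
  have hint := hs.lintegral_prod_le (fun t t' => Real.exp (θ * (ℓ t t' + h t' - h t)))
    (fun _ _ => (Real.exp_pos _).le) hρ
  have hprod : ∀ k ω, ∏ i ∈ Finset.range k,
      Real.exp (θ * (ℓ (s i ω) (s (i + 1) ω) + h (s (i + 1) ω) - h (s i ω))) =
      Real.exp (θ * (∑ i ∈ Finset.range k, ℓ (s i ω) (s (i + 1) ω)
        + (h (s k ω) - h (s 0 ω)))) := fun k ω => by
    rw [← Real.exp_sum, ← Finset.mul_sum, ← Finset.sum_range_sub (fun i => h (s i ω)),
      ← Finset.sum_add_distrib]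
    simp only [add_sub_assoc]
  simp only [hprod] at hint
  have hmeas : ∀ k, Measurable fun ω => ENNReal.ofReal (Real.exp
      (θ * (∑ i ∈ Finset.range k, ℓ (s i ω) (s (i + 1) ω) + (h (s k ω) - h (s 0 ω))))) := by
    let _ : MeasurableSpace S := ⊤
    have hsm : ∀ k, Measurable (s k) := fun k =>
      measurable_to_countable' fun a => hs.measurableSet_eq k a
    have hℓ : ∀ i, Measurable fun ω => ℓ (s i ω) (s (i + 1) ω) := fun i =>
      (measurable_from_top (f := fun q : S × S => ℓ q.1 q.2) |>.mono
        (le_of_eq (by ext; simp [MeasurableSet.of_discrete])) le_rfl).comp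
          ((hsm i).prodMk (hsm (i + 1)))
    have hhm : ∀ i, Measurable fun ω => h (s i ω) := fun i => measurable_from_top.comp (hsm i)
    intro k
    exact ENNReal.measurable_ofReal.comp (Real.measurable_exp.comp
      (((Finset.measurable_sum _ fun i _ => hℓ i).add ((hhm k).sub (hhm 0))).const_mul θ))
  have hsum : ∫⁻ ω, ∑' k, ENNReal.ofReal (Real.exp
      (θ * (∑ i ∈ Finset.range k, ℓ (s i ω) (s (i + 1) ω) + (h (s k ω) - h (s 0 ω))))) ∂ℙ
      ≠ ⊤ := by
    rw [lintegral_tsum fun k => (hmeas k).aemeasurable]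
    refine ne_top_of_le_ne_top ?_ (ENNReal.tsum_le_tsum hint)
    rw [← ENNReal.ofReal_tsum_of_nonneg (fun k => pow_nonneg hρ0 k)
      (summable_geometric_of_lt_one hρ0 hρ1)]
    exact ENNReal.ofReal_ne_top
  filter_upwards [ae_lt_top (Measurable.tsum hmeas) hsum] with ω hω
  have h0 := ENNReal.tendsto_atTop_zero_of_tsum_ne_top hω.ne
  have h1 := (ENNReal.tendsto_toReal ENNReal.zero_ne_top).comp h0
  simp only [Function.comp_def, ENNReal.toReal_ofReal (Real.exp_pos _).le,
    ENNReal.toReal_zero] at h1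
  have h2 := (Real.tendsto_exp_comp_nhds_zero.1 h1).const_mul_atBot (inv_pos.2 hθ)
  simp only [inv_mul_cancel_left₀ hθ.ne'] at h2
  obtain ⟨K, hK⟩ : ∃ K, ∀ t, -h t ≤ K := by
    obtain ⟨K, hK⟩ := (Set.finite_range fun t => -h t).bddAbove
    exact ⟨K, fun t => hK ⟨t, rfl⟩⟩
  refine tendsto_atBot_mono (fun k => ?_) (tendsto_atBot_add_const_right _ (K + h (s 0 ω)) h2)
  linarith [hK (s k ω)]

end DTMC

/-! ### Trajectories with vanishing Lyapunov values -/

lemma switchedState_smul {S : Type*} {n : ℕ} (A : S → Matrix (Fin n) (Fin n) ℝ) (t : ℝ)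
    (x₀ : Fin n → ℝ) (σ : ℕ → S) (k : ℕ) :
    switchedState A (t • x₀) σ k = t • switchedState A x₀ σ k := by
  induction k with
  | zero => rfl
  | succ k ih => rw [switchedState, ih, Matrix.mulVec_smul, switchedState]

lemma exists_norm_mulVec_le {S : Type*} [Fintype S] {n : ℕ}
    (A : S → Matrix (Fin n) (Fin n) ℝ) :
    ∃ L : ℝ, ∀ s x, ‖(A s).mulVec x‖ ≤ L * ‖x‖ := by
  let B : S → (Fin n → ℝ) →L[ℝ] (Fin n → ℝ) := fun s => (A s).mulVecLin.toContinuousLinearMap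
  obtain ⟨L, hL⟩ := (Set.finite_range fun s => ‖B s‖).bddAbove
  exact ⟨L, fun s x => ((B s).le_opNorm x).trans
    (mul_le_mul_of_nonneg_right (hL ⟨s, rfl⟩) (norm_nonneg x))⟩

lemma IsLyapunovCandidate.exists_lower_bound {S : Type*} [Fintype S] {n : ℕ}
    {V : S → (Fin n → ℝ) → ℝ} (hV : IsLyapunovCandidate V) {δ : ℝ} (hδ : 0 < δ) (R : ℝ) :
    ∃ m : ℝ, 0 < m ∧ ∀ s x, δ ≤ ‖x‖ → ‖x‖ ≤ R → m ≤ V s x := by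
  have hK : IsCompact {x : Fin n → ℝ | δ ≤ ‖x‖ ∧ ‖x‖ ≤ R} := by
    refine Metric.isCompact_of_isClosed_isBounded
      ((isClosed_le continuous_const continuous_norm).inter
        (isClosed_le continuous_norm continuous_const)) ?_
    exact (Metric.isBounded_closedBall (x := 0) (r := R)).subset fun x hx => by simpa using hx.2
  have hmode : ∀ s, ∃ m : ℝ, 0 < m ∧ ∀ x, δ ≤ ‖x‖ → ‖x‖ ≤ R → m ≤ V s x := fun s => by
    rcases {x : Fin n → ℝ | δ ≤ ‖x‖ ∧ ‖x‖ ≤ R}.eq_empty_or_nonempty with he | hne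
    · exact ⟨1, one_pos, fun x h1 h2 => (Set.eq_empty_iff_forall_notMem.1 he x ⟨h1, h2⟩).elim⟩
    · obtain ⟨z, hz, hmin⟩ := hK.exists_isMinOn hne (hV.continuous s).continuousOn
      exact ⟨V s z, hV.pos s z (norm_pos_iff.1 (hδ.trans_le hz.1)),
        fun x h1 h2 => hmin ⟨h1, h2⟩⟩
  choose m hm0 hm using hmode
  rcases isEmpty_or_nonempty S with hS | hS
  · exact ⟨1, one_pos, fun s => hS.elim s⟩
  · obtain ⟨t, ht⟩ := Finite.exists_min m
    exact ⟨m t, hm0 t, fun s x h1 h2 => (ht s).trans (hm s x h1 h2)⟩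

/-- A switched linear system along a fixed mode sequence tends to `0` if the Lyapunov values
do, at a rate that is uniform in the initial state. -/
lemma tendsto_norm_switchedState {S : Type*} [Fintype S] {n : ℕ}
    {A : S → Matrix (Fin n) (Fin n) ℝ} {V : S → (Fin n → ℝ) → ℝ} (hV : IsLyapunovCandidate V)
    {σ : ℕ → S} {c : ℕ → ℝ} (hc : Tendsto c atTop (𝓝 0))
    (hbound : ∀ x₀ k, V (σ k) (switchedState A x₀ σ k) ≤ c k * V (σ 0) x₀)
    (x₀ : Fin n → ℝ) : Tendsto (fun k => ‖switchedState A x₀ σ k‖) atTop (𝓝 0) := by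
  have hnonneg : ∀ s x, 0 ≤ V s x := fun s x => by
    rcases eq_or_ne x 0 with rfl | hx
    · exact (hV.zero s).ge
    · exact (hV.pos s x hx).le
  obtain ⟨L, hL⟩ := exists_norm_mulVec_le A
  obtain ⟨m, hm0, hm⟩ := hV.exists_lower_bound one_pos (max L 0)
  obtain ⟨K, hK⟩ := hc.bddAbove_range
  -- scale the initial state into the unit ball, to Lyapunov values that never reach `m`
  obtain ⟨t, ht0, htx, htV⟩ : ∃ t : ℝ, 0 < t ∧ ‖t • x₀‖ < 1 ∧ K * V (σ 0) (t • x₀) < m := by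
    have hcont : Continuous fun t : ℝ => t • x₀ := continuous_id.smul continuous_const
    have h1 : ∀ᶠ t : ℝ in 𝓝 0, ‖t • x₀‖ < 1 :=
      hcont.norm.continuousAt.eventually_lt continuousAt_const (by simp)
    have h2 : ∀ᶠ t : ℝ in 𝓝 0, K * V (σ 0) (t • x₀) < m :=
      (((hV.continuous (σ 0)).comp hcont).const_mul K).continuousAt.eventually_lt
        continuousAt_const (by simpa [hV.zero] using hm0)
    obtain ⟨t, ⟨ht1, ht2⟩, ht0⟩ :=
      (((h1.and h2).filter_mono nhdsWithin_le_nhds).and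
        (self_mem_nhdsWithin : Set.Ioi (0 : ℝ) ∈ 𝓝[>] 0)).exists
    exact ⟨t, ht0, ht1, ht2⟩
  have hball : ∀ k, ‖switchedState A (t • x₀) σ k‖ < 1 := fun k => by
    induction k with
    | zero => exact htx
    | succ k ih =>
      by_contra! hge
      have hle : ‖switchedState A (t • x₀) σ (k + 1)‖ ≤ max L 0 := by
        refine (hL _ _).trans ?_
        calc L * ‖switchedState A (t • x₀) σ k‖
            ≤ max L 0 * ‖switchedState A (t • x₀) σ k‖ :=
              mul_le_mul_of_nonneg_right (le_max_left _ _) (norm_nonneg _)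
          _ ≤ max L 0 := mul_le_of_le_one_right (le_max_right _ _) ih.le
      have h1 := hm (σ (k + 1)) _ hge hle
      have h2 := hbound (t • x₀) (k + 1)
      have h3 := mul_le_mul_of_nonneg_right (hK ⟨k + 1, rfl⟩) (hnonneg (σ 0) (t • x₀))
      linarith
  have hy : Tendsto (fun k => ‖switchedState A (t • x₀) σ k‖) atTop (𝓝 0) := by
    refine (tendsto_order.2 ⟨fun a ha => .of_forall fun k => ha.trans_le (norm_nonneg _),
      fun δ hδ => ?_⟩)
    obtain ⟨m', hm0', hm'⟩ := hV.exists_lower_bound hδ 1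
    have hlim : Tendsto (fun k => c k * V (σ 0) (t • x₀)) atTop (𝓝 0) := by
      simpa using hc.mul_const (V (σ 0) (t • x₀))
    filter_upwards [hlim.eventually_lt_const hm0'] with k hk
    by_contra! hge
    linarith [hm' (σ k) _ hge (hball k).le, hbound (t • x₀) k]
  have := hy.const_mul t⁻¹
  simp only [switchedState_smul, norm_smul, Real.norm_of_nonneg ht0.le, mul_zero,
    inv_mul_cancel_left₀ ht0.ne'] at this
  exact this

/-! ### Stability of the switched system -/

open Classical in
/-- The logarithm of the factor `1 - α`, times `μ` in case of a jump, by which the Lyapunov value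
grows at most in a transition from mode `s` to mode `s'`. -/
noncomputable def logGrowth {S : Type*} (α μ : ℝ) (s s' : S) : ℝ :=
  Real.log (1 - α) + if s = s' then 0 else Real.log μ

lemma lyapunov_le_exp_sum_logGrowth {S : Type*} {n : ℕ} {A : S → Matrix (Fin n) (Fin n) ℝ}
    {α μ : ℝ} (hα : α < 1) (hμ : 0 < μ) {V : S → (Fin n → ℝ) → ℝ}
    (hdecrease : ∀ s x, V s ((A s).mulVec x) - V s x ≤ -α * V s x)
    (hjump : ∀ s s' x, V s x ≤ μ * V s' x) (σ : ℕ → S) (x₀ : Fin n → ℝ) (k : ℕ) :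
    V (σ k) (switchedState A x₀ σ k) ≤
      Real.exp (∑ i ∈ Finset.range k, logGrowth α μ (σ i) (σ (i + 1))) * V (σ 0) x₀ := by
  have hstep : ∀ s s' x, V s' ((A s).mulVec x) ≤ Real.exp (logGrowth α μ s s') * V s x := by
    intro s s' x
    have hd : V s ((A s).mulVec x) ≤ (1 - α) * V s x := by linarith [hdecrease s x]
    rw [logGrowth, Real.exp_add, Real.exp_log (sub_pos.2 hα)]
    split_ifs with h
    · subst h
      simpa using hd
    · rw [Real.exp_log hμ]
      calc V s' ((A s).mulVec x) ≤ μ * V s ((A s).mulVec x) := hjump _ _ _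
        _ ≤ μ * ((1 - α) * V s x) := mul_le_mul_of_nonneg_left hd hμ.le
        _ = (1 - α) * μ * V s x := by ring
  induction k with
  | zero => simp [switchedState]
  | succ k ih =>
    rw [Finset.sum_range_succ, Real.exp_add, mul_comm (Real.exp _), mul_assoc]
    exact (hstep _ _ _).trans (mul_le_mul_of_nonneg_left ih (Real.exp_pos _).le)

lemma DTMC.stationary_mean_logGrowth {S : Type*} [Fintype S] (C : DTMC S) {p : S → ℝ}
    (hp : C.IsStationary p) (α μ : ℝ) :
    ∑ t, p t * ∑ t', C.P t t' * logGrowth α μ t t' =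
      Real.log (1 - α) + C.jumpProb p * Real.log μ := by
  classical
  have hrow : ∀ t, ∑ t', C.P t t' * logGrowth α μ t t' =
      Real.log (1 - α) + (1 - C.P t t) * Real.log μ := fun t => by
    have hterm : ∀ t', C.P t t' * logGrowth α μ t t' =
        C.P t t' * (Real.log (1 - α) + Real.log μ) -
          if t = t' then C.P t t' * Real.log μ else 0 := fun t' => by
      rw [logGrowth]
      split_ifs <;> ring
    simp only [hterm, Finset.sum_sub_distrib, ← Finset.sum_mul, C.P_row, Finset.sum_ite_eq,
      Finset.mem_univ, if_true]
    ring
  have hterm : ∀ t, p t * (Real.log (1 - α) + (1 - C.P t t) * Real.log μ) =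
      p t * (Real.log (1 - α) + Real.log μ) - p t * C.P t t * Real.log μ := fun t => by ring
  simp only [hrow, hterm, Finset.sum_sub_distrib, ← Finset.sum_mul, hp.sum_eq_one]
  rw [DTMC.jumpProb]
  ring

theorem mainTheorem2 {S Act : Type*} [Fintype S] [Fintype Act] {n : ℕ}
    (A : S → Matrix (Fin n) (Fin n) ℝ) (M : MDP S Act) (π : M.Policy)
    (α μ : ℝ) (hα₀ : 0 < α) (hα₁ : α < 1) (hμ : 1 < μ)
    (V : S → (Fin n → ℝ) → ℝ) (hV : IsLyapunovCandidate V)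
    (hdecrease : ∀ s x, V s ((A s).mulVec x) - V s x ≤ -α * V s x)
    (hjump : ∀ s s' x, V s x ≤ μ * V s' x)
    (p : S → ℝ) (hp : (M.induced π).IsStationary p)
    (hunique : ∀ q, (M.induced π).IsStationary q → q = p)
    (hP : (M.induced π).jumpProb p < Real.log (1 / (1 - α)) / Real.log μ)
    {Ω : Type*} [MeasurableSpace Ω] (ℙ : Measure Ω) [IsProbabilityMeasure ℙ]
    (s : ℕ → Ω → S) (hs : (M.induced π).IsRealization ℙ s) :
    StableWithProbabilityOne A ℙ s := by

  have hneg : ∑ t, p t * ∑ t', (M.induced π).P t t' * logGrowth α μ t t' < 0 := by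
    rw [(M.induced π).stationary_mean_logGrowth hp]
    have h := (lt_div_iff₀ (Real.log_pos hμ)).1 hP
    rw [one_div, Real.log_inv] at h
    linarith
  intro x₀
  filter_upwards [hs.ae_tendsto_sum_atBot hp hunique _ hneg] with ω hω
  exact tendsto_norm_switchedState hV (Real.tendsto_exp_atBot.comp hω)
    (lyapunov_le_exp_sum_logGrowth hα₁ (one_pos.trans hμ) hdecrease hjump fun i => s i ω) x₀
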